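/- Let $N$ be an integer, let $n\ge 0$, let $f_1,\dots,f_n\in\mathbb Z[t]$ be non-constant polynomials with positive leading coefficients, and let $g_0,g_1,\dots,g_n\in\mathbb Q(t)$ be rational functions. Write $v_t$ for the $t$-adic valuation on $\mathbb Q(t)$, with $v_t(0)=+\infty$, and set $$M=\min_{0\le i\le n} v_t(g_i)\in\mathbb Z\cup\{+\infty\}.$$ Let $B_0,B_1,B_2,\dots$ be the Bernoulli numbers, defined by $\frac{x}{e^x-1}=\sum_{k\ge 0}B_k\frac{x^k}{k!}$. For rational numbers $a,b$ and a prime $p$, write $a\equiv b \bmod p^N$ if the $p$-adic valuation of $a-b$ is at least $N$ (the valuation of $0$ being $+\infty$). Suppose that all of the following conditions hold (no $m$ satisfies $m\le N-M$ if $M=+\infty$). 1. $$v_t\Bigl(g_0(t)-\Bigl(1-\frac1t\Bigr)\sum_{i\ge 1:\,f_i(1)=0}g_i(t)-\sum_{i\ge 1:\,f_i(1)\ge 2}\bigl(1-t^{f_i(1)-1}\bigr)\frac{B_{f_i(1)}}{f_i(1)}\,g_i(t)f_i(t)\Bigr)\ge N.$$ 2. For every even integer $k\le 0$ with $k\in\{f_1(1),\dots,f_n(1)\}$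 and every integer $m$ with $1\le m\le N-M$, $$v_t\Bigl(\sum_{i\ge 1:\,f_i(1)=k}g_i(t)f_i(t)^m\Bigr)\ge N+1-m.$$ 3. For every even integer $k>0$ with $k\in\{f_1(1),\dots,f_n(1)\}$ and every integer $m$ with $2\le m\le N-M$, $$v_t\Bigl(\sum_{i\ge 1:\,f_i(1)=k}g_i(t)\bigl(f_i(t)^m-k^{m-1}f_i(t)\bigr)\Bigr)\ge N+1-m.$$ Then for every sufficiently large prime $p$, $$\sum_{i=1}^n g_i(p)\,B_{f_i(p)}\equiv g_0(p) \bmod p^N.$$ -/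

import Mathlib

open Polynomial

section

open scoped RatFunc

/-- The `t`-adic valuation `v_t` on `ℚ(t)`, with `v_t(0) = ⊤`: the order at `t = 0` of the Laurent
expansion of a rational function. -/
noncomputable def tVal : AddValuation (RatFunc ℚ) (WithTop ℤ) :=
  (HahnSeries.addVal ℤ ℚ).comap (algebraMap (RatFunc ℚ) (LaurentSeries ℚ))

end

/-- An integer polynomial, regarded as an element of `ℚ(t)`. -/
noncomputable def toRatFunc (f : ℤ[X]) : RatFunc ℚ :=
  algebraMap ℚ[X] (RatFunc ℚ) (f.map (Int.castRingHom ℚ))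

/-- The congruence `a ≡ b mod p ^ N` of rational numbers: the `p`-adic valuation of `a - b` is at
least `N`, where the valuation of `0` is infinite. -/
def RatCongr (p : ℕ) (N : ℤ) (a b : ℚ) : Prop :=
  a = b ∨ N ≤ padicValRat p (a - b)

/-- The Bernoulli number `B_k` (with `B_1 = -1/2`), indexed by an integer `k`; only used for
`k ≥ 0`. -/
def bern (k : ℤ) : ℚ := bernoulli k.toNat

/-- The value `g(x)` of a rational function at a rational number that is not a pole. -/
noncomputable def evalAt (x : ℚ) (g : RatFunc ℚ) : ℚ := g.eval (RingHom.id ℚ) x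

/-!
Let `φ` be the linear functional on `ℚ[X]` with `φ (X ^ n) = B_n`. Raabe's multiplication formula
`φ P = p⁻¹ ∑_{a < p} φ (P (a + p X))` writes the Bernoulli number without its Euler factor,
`(1 - p ^ (n - 1)) B_n`, as `p⁻¹ ∑_{0 < a < p} φ ((a + p X) ^ n)`. Taking `j` differences of step
`p - 1` in `n` inserts the factor `((a + p X) ^ (p - 1) - 1) ^ j`, divisible by `p ^ j` up to the
denominators of `φ`. By Newton's formula, on each residue class modulo `p - 1` these numbers agree
modulo `p ^ L` with the values at `n` of a polynomial whose coefficient of `X ^ m` is divisible by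
`p ^ (m - 1)`.

Now group the `i` by `k = f_i(1)`, since `f_i(p) ≡ f_i(1)` modulo `p - 1`. For odd `k` everything
vanishes. For even `k`, conditions 2 and 3 say that the functional `P ↦ ∑ g_i(p) P(f_i(p))`,
corrected for `k > 0` by a multiple of `P ↦ P(k)`, is divisible by `p ^ (N + 1 - m)` at `X ^ m` for
`m ≥ 1`. Hence only the constant term (`k ≤ 0`) or the value at `k` (`k > 0`) of the interpolating
polynomial survives, and this is the main term in condition 1. The `t`-adic conditions become
`p`-adic ones at all large primes `p`.
-/

section PadicBall

variable {p : ℕ} [hp : Fact p.Prime] {N M K : ℤ} {x y : ℚ}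

/-- The rational numbers of `p`-adic valuation at least `N`. Congruences modulo `p ^ N` are
membership of a difference in this subgroup, so that they can be added and summed. -/
def padicBall (p : ℕ) [Fact p.Prime] (N : ℤ) : AddSubgroup ℚ where
  carrier := {x | padicNorm p x ≤ (p : ℚ) ^ (-N)}
  zero_mem' := by simpa using zpow_nonneg (Nat.cast_nonneg (α := ℚ) p) (-N)
  add_mem' hx hy := padicNorm.nonarchimedean.trans (max_le hx hy)
  neg_mem' hx := by simpa using hx

namespace padicBall

theorem mem_iff : x ∈ padicBall p N ↔ padicNorm p x ≤ (p : ℚ) ^ (-N) := Iff.rfl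

theorem mem_of_le (hx : x ∈ padicBall p N) (hM : M ≤ N) : x ∈ padicBall p M :=
  mem_iff.2 <| (mem_iff.1 hx).trans <|
    zpow_le_zpow_right₀ (Nat.one_le_cast.2 hp.out.one_lt.le) (neg_le_neg hM)

theorem mul_mem (hx : x ∈ padicBall p N) (hy : y ∈ padicBall p M) (hK : K ≤ N + M) :
    x * y ∈ padicBall p K := by
  refine mem_of_le ?_ hK
  rw [mem_iff, padicNorm.mul, neg_add, zpow_add₀ (mod_cast hp.out.ne_zero)]
  exact mul_le_mul hx hy (padicNorm.nonneg _) (zpow_nonneg (Nat.cast_nonneg p) _)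

theorem intCast_mem (z : ℤ) : (z : ℚ) ∈ padicBall p 0 := by
  simpa [mem_iff] using padicNorm.of_int z

theorem natCast_mem (z : ℕ) : (z : ℚ) ∈ padicBall p 0 := by
  simpa [mem_iff] using padicNorm.of_nat z

theorem pow_mem (hx : x ∈ padicBall p 0) (m : ℕ) : x ^ m ∈ padicBall p 0 := by
  induction m with
  | zero => simpa using natCast_mem 1
  | succ m ih => simpa only [pow_succ] using mul_mem ih hx (by simp)

theorem intCast_mem_of_dvd {n : ℕ} {z : ℤ} (h : (p : ℤ) ^ n ∣ z) : (z : ℚ) ∈ padicBall p n :=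
  padicNorm.dvd_iff_norm_le.1 (by exact_mod_cast h)

theorem zpow_self_mem (k : ℤ) : (p : ℚ) ^ k ∈ padicBall p k := by
  rw [mem_iff, padicNorm.eq_zpow_of_nonzero (zpow_ne_zero _ (mod_cast hp.out.ne_zero))]
  simp

theorem inv_self_mem : (p : ℚ)⁻¹ ∈ padicBall p (-1) := by
  simpa using zpow_self_mem (p := p) (-1)

theorem inv_natCast_mem {m : ℕ} (h : ¬ p ∣ m) : (m : ℚ)⁻¹ ∈ padicBall p 0 := by
  have h1 := (padicNorm.nat_eq_one_iff m).2 h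
  rw [mem_iff, ← one_div, padicNorm.div, h1]
  simp

theorem inv_mem_of_sub_mem (hy : y ≠ 0) (hy' : y⁻¹ ∈ padicBall p 0)
    (h : x - y ∈ padicBall p 1) : x⁻¹ ∈ padicBall p 0 := by
  have hp1 : (p : ℚ) ^ (-1 : ℤ) < 1 := zpow_lt_one_of_neg₀ (mod_cast hp.out.one_lt) (by simp)
  have hy1 : 1 ≤ padicNorm p y := by
    rw [mem_iff, ← one_div, padicNorm.div, padicNorm.one, neg_zero, zpow_zero] at hy'
    exact (div_le_one ((padicNorm.nonneg y).lt_of_ne' (padicNorm.nonzero hy))).1 hy'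
  have hlt : padicNorm p (x - y) < padicNorm p y := ((mem_iff.1 h).trans_lt hp1).trans_le hy1
  have hxy : padicNorm p x = padicNorm p y := by
    rw [← sub_add_cancel x y, padicNorm.add_eq_max_of_ne hlt.ne, max_eq_right hlt.le]
  rwa [mem_iff, ← one_div, padicNorm.div, hxy, ← padicNorm.div, one_div, ← mem_iff]

theorem ratCongr_of_sub_mem (h : x - y ∈ padicBall p N) : RatCongr p N x y := by
  rcases eq_or_ne x y with hxy | hxy
  · exact Or.inl hxy
  · rw [mem_iff, padicNorm.eq_zpow_of_nonzero (sub_ne_zero.2 hxy)] at h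
    exact Or.inr (neg_le_neg_iff.1 ((zpow_le_zpow_iff_right₀ (mod_cast hp.out.one_lt)).1 h))

end padicBall

end PadicBall

section CoeffBall

variable {p : ℕ} [Fact p.Prime] {w w₁ w₂ : ℕ → ℤ} {P Q : ℚ[X]}

/-- The polynomials whose coefficient of `X ^ l` has `p`-adic valuation at least `w l` for all
`l`. -/
def coeffBall (p : ℕ) [Fact p.Prime] (w : ℕ → ℤ) : AddSubgroup ℚ[X] where
  carrier := {P | ∀ l, P.coeff l ∈ padicBall p (w l)}
  zero_mem' l := by simp [zero_mem]
  add_mem' hP hQ l := by simpa only [coeff_add] using add_mem (hP l) (hQ l)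
  neg_mem' hP l := by simpa only [coeff_neg] using neg_mem (hP l)

namespace coeffBall

theorem mul_mem (hw : ∀ i j, w (i + j) ≤ w₁ i + w₂ j) (hP : P ∈ coeffBall p w₁)
    (hQ : Q ∈ coeffBall p w₂) : P * Q ∈ coeffBall p w := fun l => by
  rw [coeff_mul]
  refine sum_mem fun ij hij => padicBall.mul_mem (hP ij.1) (hQ ij.2) ?_
  rw [← (Finset.HasAntidiagonal.mem_antidiagonal.1 hij)]
  exact hw ij.1 ij.2

theorem C_mul_mem {c : ℚ} {e : ℤ} (hw : ∀ l, w l ≤ e + w₁ l) (hc : c ∈ padicBall p e)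
    (hP : P ∈ coeffBall p w₁) : C c * P ∈ coeffBall p w := fun l => by
  rw [coeff_C_mul]
  exact padicBall.mul_mem hc (hP l) (hw l)

theorem C_mem {c : ℚ} (hc : c ∈ padicBall p (w 0)) : C c ∈ coeffBall p w := fun l => by
  rw [coeff_C]
  split_ifs with h
  · exact h ▸ hc
  · exact zero_mem _

theorem X_mem (hw : w 1 ≤ 0) : X ∈ coeffBall p w := fun l => by
  rw [coeff_X]
  split_ifs with h
  · exact h ▸ padicBall.mem_of_le (by simpa using padicBall.natCast_mem 1) hw
  · exact zero_mem _

end coeffBall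

end CoeffBall

section Umbral

/-- The umbral functional of the Bernoulli numbers: the linear form on polynomials that sends
`X ^ l` to `B_l`. It is the algebraic form of the Volkenborn integral over `ℤ_p`. -/
noncomputable def bernoulliUmbral : ℚ[X] →ₗ[ℚ] ℚ :=
  lsum fun l => _root_.bernoulli l • LinearMap.id

theorem bernoulliUmbral_apply (P : ℚ[X]) :
    bernoulliUmbral P = P.sum fun l c => _root_.bernoulli l * c := rfl

theorem bernoulliUmbral_C_mul_X_pow (c : ℚ) (l : ℕ) :
    bernoulliUmbral (C c * X ^ l) = _root_.bernoulli l * c := by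
  rw [bernoulliUmbral_apply, C_mul_X_pow_eq_monomial, 
    sum_monomial_index c _ (mul_zero (_root_.bernoulli l))]

theorem bernoulliUmbral_X_pow (l : ℕ) : bernoulliUmbral (X ^ l) = _root_.bernoulli l := by
  simpa using bernoulliUmbral_C_mul_X_pow 1 l

theorem bernoulliUmbral_comp_one_add_X (P : ℚ[X]) :
    bernoulliUmbral (P.comp (1 + X)) = bernoulliUmbral P + P.derivative.eval 0 := by
  induction P using Polynomial.induction_on' with
  | add P Q hP hQ => simp only [add_comp, map_add, hP, hQ, eval_add]; ring
  | monomial n c =>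
    have hexp : (monomial n c).comp (1 + X) =
        ∑ l ∈ Finset.range (n + 1), C (c * n.choose l) * X ^ l := by
      rw [monomial_comp, add_comm, add_pow, Finset.mul_sum]
      refine Finset.sum_congr rfl fun l _ => ?_
      simp only [one_pow, mul_one, map_mul, map_natCast]
      ring
    have hsum : ∑ l ∈ Finset.range (n + 1), _root_.bernoulli l * (c * n.choose l) =
        _root_.bernoulli n * c + c * if n = 1 then 1 else 0 := by
      rw [← _root_.sum_bernoulli, Finset.sum_range_succ, Finset.mul_sum, add_comm, Nat.choose_self]
      simp [mul_comm, mul_left_comm]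
    rw [hexp, map_sum, ← C_mul_X_pow_eq_monomial, bernoulliUmbral_C_mul_X_pow]
    simp only [bernoulliUmbral_C_mul_X_pow, hsum, derivative_C_mul_X_pow, eval_mul, eval_C,
      eval_pow, eval_X]
    rcases n with _ | _ | n <;> simp

theorem linearMap_eq_zero_of_comp_one_add_X {φ : ℚ[X] →ₗ[ℚ] ℚ}
    (h : ∀ P, φ (P.comp (1 + X)) = φ P) : φ = 0 := by
  refine lhom_ext' fun n => LinearMap.ext_ring ?_
  have hn : ((n : ℚ) + 1) * φ (X ^ n) = 0 := by
    have := h (Polynomial.bernoulli (n + 1))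
    rw [bernoulli_comp_one_add_X, map_add, add_eq_left, nsmul_eq_mul, ← C_eq_natCast,
      ← smul_eq_C_mul, map_smul] at this
    simpa using this
  simpa [← X_pow_eq_monomial] using (mul_eq_zero.1 hn).resolve_left (by positivity)

/-- Raabe's multiplication formula. Both sides, as functionals `φ` of `P`, satisfy
`φ (P.comp (1 + X)) = φ P + P.derivative.eval 0`, and a linear functional is determined by this. -/
theorem bernoulliUmbral_eq_sum_comp {m : ℕ} (hm : m ≠ 0) (P : ℚ[X]) :
    bernoulliUmbral P =
      (m : ℚ)⁻¹ * ∑ a ∈ Finset.range m, bernoulliUmbral (P.comp (C (a : ℚ) + C (m : ℚ) * X)) := by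
  let U (a : ℕ) : ℚ[X] →ₗ[ℚ] ℚ :=
    bernoulliUmbral ∘ₗ (aeval (C (a : ℚ) + C (m : ℚ) * X)).toLinearMap
  have hU (a : ℕ) (P : ℚ[X]) : U a P = bernoulliUmbral (P.comp (C (a : ℚ) + C (m : ℚ) * X)) := rfl
  have hshift (a : ℕ) (P : ℚ[X]) : U a (P.comp (1 + X)) = U (a + 1) P := by
    simp only [hU, comp_assoc, add_comp, one_comp, X_comp, Nat.cast_add, Nat.cast_one, C_add, C_1]
    ring_nf
  have hwrap (P : ℚ[X]) : U m P = U 0 P + m * P.derivative.eval 0 := by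
    have : P.comp (C (m : ℚ) + C (m : ℚ) * X) = (P.comp (C (m : ℚ) * X)).comp (1 + X) := by
      simp [comp_assoc, mul_add]
    rw [hU, hU, this, bernoulliUmbral_comp_one_add_X]
    simp [derivative_comp]
  have hφ : bernoulliUmbral - (m : ℚ)⁻¹ • ∑ a ∈ Finset.range m, U a = 0 := by
    refine linearMap_eq_zero_of_comp_one_add_X fun P => ?_
    have htel := Finset.sum_range_succ_comm (U · P) m ▸ Finset.sum_range_succ' (U · P) m
    simp only [LinearMap.sub_apply, LinearMap.smul_apply, LinearMap.sum_apply, smul_eq_mul,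
      hshift, bernoulliUmbral_comp_one_add_X]
    rw [hwrap] at htel
    field_simp
    linarith
  simpa [sub_eq_zero, hU] using LinearMap.congr_fun hφ P

end Umbral

section Integrality

variable {p : ℕ} [hp : Fact p.Prime] {e : ℤ}

theorem bernoulli_mem_padicBall {n : ℕ} (he : e ≤ 0)
    (h : n ≠ 0 → p - 1 ∣ n → e ≤ -1) : _root_.bernoulli n ∈ padicBall p e := by
  rcases eq_or_ne n 0 with rfl | hn
  · simpa using padicBall.mem_of_le (padicBall.natCast_mem (p := p) 1) he
  have hprime {q : ℕ} (hq : q.Prime) (hqn : q - 1 ∣ n) : 1 / (q : ℚ) ∈ padicBall p e := by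
    rw [one_div]
    rcases eq_or_ne q p with rfl | hqp
    · exact padicBall.mem_of_le padicBall.inv_self_mem (h hn hqn)
    · exact padicBall.mem_of_le (padicBall.inv_natCast_mem fun hpq =>
        hqp ((Nat.prime_dvd_prime_iff_eq hp.out hq).1 hpq).symm) he
  rcases n.even_or_odd' with ⟨k, rfl | rfl⟩
  · obtain ⟨z, hz⟩ := Bernoulli.vonStaudt_clausen k
    rw [eq_sub_of_add_eq hz.symm]
    refine sub_mem (padicBall.mem_of_le (padicBall.intCast_mem z) he) (sum_mem fun q hq => ?_)
    exact hprime (Finset.mem_filter.1 hq).2.1 (Finset.mem_filter.1 hq).2.2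
  · rcases eq_or_ne k 0 with rfl | hk
    · rw [mul_zero, zero_add, _root_.bernoulli_one, neg_div]
      exact neg_mem (by exact_mod_cast hprime Nat.prime_two (one_dvd _))
    · rw [bernoulli_eq_zero_of_odd ⟨k, rfl⟩ (by lia)]
      exact zero_mem _

theorem bernoulliUmbral_mem_padicBall {j : ℕ} {P : ℚ[X]}
    (hP : P ∈ coeffBall p fun l => max (j : ℤ) l) (he : e ≤ j) (h : p - 1 ≤ j → e ≤ j - 1) :
    bernoulliUmbral P ∈ padicBall p e := by
  rw [bernoulliUmbral_apply]
  refine sum_mem fun l _ => ?_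
  refine padicBall.mul_mem (bernoulli_mem_padicBall (e := e - max (j : ℤ) l) ?_ ?_) (hP l)
    (sub_add_cancel _ _).ge
  · lia
  · intro hl hdvd
    have := Nat.le_of_dvd (Nat.pos_of_ne_zero hl) hdvd
    lia

end Integrality

section EulerBernoulli

open fwdDiff

/-- The Bernoulli number `B_n` with its Euler factor at `p` removed, as in the Kummer congruences.
The exponent is an integer, so that the value at `n = 0` is `1 - 1 / p`. -/
def eulerBernoulli (p n : ℕ) : ℚ := (1 - (p : ℚ) ^ ((n : ℤ) - 1)) * _root_.bernoulli n

theorem eulerBernoulli_eq_sum {p : ℕ} (hp : p ≠ 0) (n : ℕ) :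
    eulerBernoulli p n = ∑ a ∈ Finset.Ico 1 p,
      ((p : ℚ)⁻¹ • bernoulliUmbral) ((C (a : ℚ) + C (p : ℚ) * X) ^ n) := by
  have hraabe := bernoulliUmbral_eq_sum_comp hp (X ^ n)
  have hzero : bernoulliUmbral ((C (0 : ℚ) + C (p : ℚ) * X) ^ n) = p ^ n * _root_.bernoulli n := by
    rw [C_0, zero_add, mul_pow, ← C_pow, bernoulliUmbral_C_mul_X_pow, mul_comm]
  simp only [X_pow_comp, bernoulliUmbral_X_pow] at hraabe
  rw [Finset.range_eq_Ico, Finset.sum_eq_sum_Ico_succ_bot (Nat.pos_of_ne_zero hp), Nat.cast_zero,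
    hzero] at hraabe
  simp only [LinearMap.smul_apply, smul_eq_mul, ← Finset.mul_sum]
  rw [eulerBernoulli, zpow_sub_one₀ (Nat.cast_ne_zero.2 hp), zpow_natCast]
  linear_combination hraabe

theorem fwdDiff_iter_sum_map_pow {ι R A : Type*} [CommRing R] [AddCommGroup A] (s : Finset ι)
    (φ : R →+ A) (y : ι → R) (h j k : ℕ) :
    Δ_[h] ^[j] (fun n => ∑ i ∈ s, φ (y i ^ n)) k = ∑ i ∈ s, φ ((y i ^ h - 1) ^ j * y i ^ k) := by
  induction j generalizing k with
  | zero => simp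
  | succ j ih =>
    rw [Function.iterate_succ_apply', fwdDiff, ih, ih, ← Finset.sum_sub_distrib]
    refine Finset.sum_congr rfl fun i _ => ?_
    rw [← map_sub]
    ring_nf

variable {p : ℕ} [hp : Fact p.Prime] {e : ℤ}

namespace coeffBall

theorem pow_mem_max {P : ℚ[X]} {j : ℕ} (hP : P ∈ coeffBall p fun l => max (j : ℤ) l) (m : ℕ) :
    P ^ m ∈ coeffBall p fun l => max ((j * m : ℕ) : ℤ) l := by
  induction m with
  | zero => simpa using C_mem (c := 1) (by simpa using padicBall.natCast_mem 1)
  | succ m ih =>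
    rw [pow_succ]
    exact mul_mem (fun i l => by push_cast; lia) ih hP

theorem linear_pow_mem (a n : ℕ) :
    (C (a : ℚ) + C (p : ℚ) * X) ^ n ∈ coeffBall p fun l => max ((0 : ℕ) : ℤ) l := by
  have hp1 : (p : ℚ) ∈ padicBall p 1 := by simpa using padicBall.zpow_self_mem (p := p) 1
  have hlin : C (a : ℚ) + C (p : ℚ) * X ∈ coeffBall p fun l => max ((0 : ℕ) : ℤ) l :=
    add_mem (C_mem (by simpa using padicBall.natCast_mem a))
      (C_mul_mem (w₁ := fun l => l - 1) (fun l => by lia) hp1 (X_mem (by simp)))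
  simpa using pow_mem_max hlin n

theorem linear_pow_sub_one_mem {a : ℕ} (ha : a ∈ Finset.Ico 1 p) :
    (C (a : ℚ) + C (p : ℚ) * X) ^ (p - 1) - 1 ∈ coeffBall p fun l => max ((1 : ℕ) : ℤ) l := by
  have hfermat : (p : ℤ) ∣ (a : ℤ) ^ (p - 1) - 1 := by
    rw [Finset.mem_Ico] at ha
    have ha0 : (a : ZMod p) ≠ 0 := fun h =>
      absurd (Nat.le_of_dvd ha.1 ((ZMod.natCast_eq_zero_iff a p).1 h)) ha.2.not_ge
    rw [← ZMod.intCast_zmod_eq_zero_iff_dvd]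
    simp [ZMod.pow_card_sub_one_eq_one ha0]
  intro l
  rcases l with _ | l
  · have hcoeff : ((C (a : ℚ) + C (p : ℚ) * X) ^ (p - 1) - 1).coeff 0 =
        (((a : ℤ) ^ (p - 1) - 1 : ℤ) : ℚ) := by
      simp [coeff_zero_eq_eval_zero]
    rw [hcoeff]
    exact padicBall.intCast_mem_of_dvd (by simpa using hfermat)
  · have hcoeff := linear_pow_mem (p := p) a (p - 1) (l + 1)
    rw [coeff_sub, coeff_one, if_neg l.succ_ne_zero, sub_zero]
    exact padicBall.mem_of_le hcoeff (by push_cast; lia)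

end coeffBall

theorem fwdDiff_iter_eulerBernoulli_mem {j : ℕ} (k : ℕ) (he : e ≤ j - 1)
    (h : p - 1 ≤ j → e ≤ j - 2) :
    Δ_[p - 1] ^[j] (eulerBernoulli p) k ∈ padicBall p e := by
  rw [funext (eulerBernoulli_eq_sum hp.out.ne_zero)]
  have hdiff := fwdDiff_iter_sum_map_pow (Finset.Ico 1 p)
    ((p : ℚ)⁻¹ • bernoulliUmbral).toAddMonoidHom (fun a : ℕ => C (a : ℚ) + C (p : ℚ) * X)
    (p - 1) j k
  simp only [LinearMap.toAddMonoidHom_coe] at hdiff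
  rw [hdiff]
  refine sum_mem fun a ha => ?_
  have hpoly : ((C (a : ℚ) + C (p : ℚ) * X) ^ (p - 1) - 1) ^ j * (C (a : ℚ) + C (p : ℚ) * X) ^ k ∈
      coeffBall p fun l => max (j : ℤ) l :=
    coeffBall.mul_mem (fun i l => by push_cast; lia)
      (coeffBall.pow_mem_max (coeffBall.linear_pow_sub_one_mem ha) j)
      (coeffBall.linear_pow_mem a k)
  exact padicBall.mul_mem padicBall.inv_self_mem
    (bernoulliUmbral_mem_padicBall (e := e + 1) hpoly (by lia) (by lia)) (by lia)

end EulerBernoulli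

section Teichmuller

variable {p : ℕ} [hp : Fact p.Prime] {k : ℕ}

theorem pow_succ_dvd_pow_sub_pow {R : Type*} [CommRing R] {p : ℕ} {a b : R} (h : (p : R) ∣ a - b)
    (r k : ℕ) : (p : R) ^ (r + 1) ∣ a ^ (p ^ r * k) - b ^ (p ^ r * k) := by
  rw [pow_mul, pow_mul]
  exact (dvd_sub_pow_of_dvd_sub h r).trans (sub_dvd_pow_sub_pow _ _ k)

theorem exists_not_dvd_pow_sub_one (hk : ¬ p - 1 ∣ k) (r : ℕ) :
    ∃ c : ℕ, ¬ p ∣ c ∧ ¬ (p : ℤ) ∣ (c : ℤ) ^ (p ^ r * k) - 1 := by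
  obtain ⟨u, hu⟩ : ∃ u : (ZMod p)ˣ, u ^ k ≠ 1 := by
    by_contra! h
    exact hk (by simpa using (FiniteField.forall_pow_eq_one_iff (ZMod p) k).1 h)
  refine ⟨(u : ZMod p).val, ?_, ?_⟩
  · rw [← ZMod.natCast_eq_zero_iff, ZMod.natCast_zmod_val]
    exact u.ne_zero
  · rw [← ZMod.intCast_zmod_eq_zero_iff_dvd]
    simpa [pow_mul, ZMod.pow_card_pow, sub_eq_zero, Units.ext_iff] using hu

/-- The map `a ↦ a ^ (p ^ r * k)` modulo `p ^ (r + 1)` is a multiplicative character of `ZMod p`,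
nontrivial since `p - 1 ∤ k`; multiplying `a` by a suitable `c` permutes the summands. -/
theorem pow_succ_dvd_sum_range_pow (hk : ¬ p - 1 ∣ k) (r : ℕ) :
    (p : ℤ) ^ (r + 1) ∣ ∑ a ∈ Finset.range p, (a : ℤ) ^ (p ^ r * k) := by
  obtain ⟨c, hc, hck⟩ := exists_not_dvd_pow_sub_one hk r
  have hc0 : (c : ZMod p) ≠ 0 := (ZMod.natCast_eq_zero_iff c p).not.2 hc
  set χ : ZMod p → ℤ := fun x => (x.val : ℤ) ^ (p ^ r * k) with hχ
  have hsum : ∑ a ∈ Finset.range p, (a : ℤ) ^ (p ^ r * k) = ∑ x, χ x := by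
    refine Finset.sum_nbij' (fun a => (a : ZMod p)) ZMod.val (by simp)
      (fun x _ => Finset.mem_range.2 x.val_lt)
      (fun a ha => ZMod.val_cast_of_lt (Finset.mem_range.1 ha)) (by simp) fun a ha => ?_
    rw [hχ]
    simp only [ZMod.val_cast_of_lt (Finset.mem_range.1 ha)]
  have hmul (x : ZMod p) : (p : ℤ) ^ (r + 1) ∣ (c : ℤ) ^ (p ^ r * k) * χ x - χ (c * x) := by
    rw [hχ, ← mul_pow]
    refine pow_succ_dvd_pow_sub_pow ?_ r k
    rw [← ZMod.intCast_zmod_eq_zero_iff_dvd]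
    simp
  have hperm : ∑ x, χ (c * x) = ∑ x, χ x := Equiv.sum_comp (Equiv.mulLeft₀ (c : ZMod p) hc0) χ
  have hdvd : (p : ℤ) ^ (r + 1) ∣ ((c : ℤ) ^ (p ^ r * k) - 1) * ∑ x, χ x := by
    rw [sub_one_mul, Finset.mul_sum, ← hperm, ← Finset.sum_sub_distrib]
    exact Finset.dvd_sum fun x _ => hmul x
  rw [hsum]
  have hp_int : Prime (p : ℤ) := Nat.prime_iff_prime_int.1 hp.out
  exact (hp_int.coprime_iff_not_dvd.2 hck).pow_left.dvd_of_dvd_mul_left hdvd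

end Teichmuller

section Interpolation

open fwdDiff

variable {p : ℕ} [hp : Fact p.Prime]

theorem coeffBall.linear_pow_sub_C_mem (a r k : ℕ) :
    (C (a : ℚ) + C (p : ℚ) * X) ^ (p ^ r * k) - C ((a : ℚ) ^ (p ^ r * k)) ∈
      coeffBall p fun l => max ((r + 1 : ℕ) : ℤ) l := fun l => by
  have hdvd : ((p ^ (r + 1) : ℕ) : ℤ) ∣
      ((C (a : ℤ) + C (p : ℤ) * X) ^ (p ^ r * k) - C (a : ℤ) ^ (p ^ r * k)).coeff l := by
    refine C_dvd_iff_dvd_coeff _ _ |>.1 ?_ l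
    simpa using pow_succ_dvd_pow_sub_pow (by simp) r k
  have hconst : ((C (a : ℚ) + C (p : ℚ) * X) ^ (p ^ r * k) - C ((a : ℚ) ^ (p ^ r * k))).coeff l ∈
      padicBall p (r + 1 : ℕ) := by
    have hmap : (C (a : ℚ) + C (p : ℚ) * X) ^ (p ^ r * k) - C ((a : ℚ) ^ (p ^ r * k)) =
        ((C (a : ℤ) + C (p : ℤ) * X) ^ (p ^ r * k) - C (a : ℤ) ^ (p ^ r * k)).map
          (Int.castRingHom ℚ) := by
      simp
    rw [hmap, coeff_map]
    exact padicBall.intCast_mem_of_dvd (by exact_mod_cast hdvd)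
  rcases le_total (l : ℤ) (r + 1 : ℕ) with hl | hl
  · simpa only [max_eq_left hl] using hconst
  · have hl0 : l ≠ 0 := by lia
    simp only [coeff_sub, coeff_C, if_neg hl0, sub_zero, max_eq_right hl]
    simpa using coeffBall.linear_pow_mem a (p ^ r * k) l

theorem eulerBernoulli_pow_mul_mem {k : ℕ} (hk : ¬ p - 1 ∣ k) (r : ℕ) :
    eulerBernoulli p (p ^ r * k) ∈ padicBall p (r - 1) := by
  set n := p ^ r * k
  have hn0 : n ≠ 0 := mul_ne_zero (pow_ne_zero _ hp.out.ne_zero) fun h => hk (h ▸ dvd_zero _)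
  have hsplit : eulerBernoulli p n = (p : ℚ)⁻¹ * (∑ a ∈ Finset.Ico 1 p,
      bernoulliUmbral ((C (a : ℚ) + C (p : ℚ) * X) ^ n - C ((a : ℚ) ^ n)) +
      ((∑ a ∈ Finset.range p, (a : ℤ) ^ n : ℤ) : ℚ)) := by
    have hC (c : ℚ) : bernoulliUmbral (C c) = c := by
      simpa using bernoulliUmbral_C_mul_X_pow c 0
    simp only [eulerBernoulli_eq_sum hp.out.ne_zero, LinearMap.smul_apply, smul_eq_mul, map_sub,
      Finset.sum_sub_distrib, hC, ← Finset.mul_sum]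
    rw [Finset.range_eq_Ico, Finset.sum_eq_sum_Ico_succ_bot hp.out.pos]
    simp [hn0]
  rw [hsplit]
  refine padicBall.mul_mem padicBall.inv_self_mem (M := r) (add_mem (sum_mem fun a _ => ?_) ?_) ?_
  · exact bernoulliUmbral_mem_padicBall (j := r + 1) (coeffBall.linear_pow_sub_C_mem a r k)
      (by lia) (by lia)
  · exact padicBall.mem_of_le (padicBall.intCast_mem_of_dvd (pow_succ_dvd_sum_range_pow hk r))
      (by lia)
  · lia

/-- The polynomial of degree `j` that takes the value `s.choose j` at `k + h * s`, so that Newton's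
forward difference formula with step `h` from `k` reads
`∑ j, (Δ_[h] ^[j] f k) * newtonBasis k h j`. -/
noncomputable def newtonBasis (k h j : ℕ) : ℚ[X] :=
  ∏ i ∈ Finset.range j, C (((h * (i + 1) : ℕ) : ℚ)⁻¹) * (X - C ((k + h * i : ℕ) : ℚ))

theorem eval_newtonBasis (k : ℕ) {h : ℕ} (hh : h ≠ 0) (j s : ℕ) :
    (newtonBasis k h j).eval ((k + h * s : ℕ) : ℚ) = s.choose j := by
  induction j with
  | zero => simp [newtonBasis]
  | succ j ih =>
    have hchoose : ((s.choose (j + 1) : ℕ) : ℚ) * (j + 1) = s.choose j * (s - j) := by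
      rcases le_or_gt j s with hj | hj
      · rw [← Nat.cast_sub hj]
        exact_mod_cast s.choose_succ_right_eq j
      · simp [Nat.choose_eq_zero_of_lt hj, Nat.choose_eq_zero_of_lt (hj.trans j.lt_succ_self)]
    rw [newtonBasis, Finset.prod_range_succ, ← newtonBasis, eval_mul, ih]
    simp only [eval_mul, eval_C, eval_sub, eval_X]
    have hh' : (h : ℚ) ≠ 0 := Nat.cast_ne_zero.2 hh
    push_cast
    field_simp
    linear_combination -(h : ℚ) * hchoose

theorem newtonBasis_mem (k : ℕ) {h j : ℕ} (hh : ¬ p ∣ h) (hj : j < p) :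
    newtonBasis k h j ∈ coeffBall p fun l => (l : ℤ) - j := by
  induction j with
  | zero =>
    simpa [newtonBasis] using coeffBall.C_mem (c := 1) (w := fun l : ℕ => (l : ℤ))
      (by simpa using padicBall.natCast_mem 1)
  | succ j ih =>
    have hinv : (((h * (j + 1) : ℕ) : ℚ))⁻¹ ∈ padicBall p 0 :=
      padicBall.inv_natCast_mem fun hdvd => (hp.out.dvd_mul.1 hdvd).elim hh fun hdvd =>
        absurd (Nat.le_of_dvd j.succ_pos hdvd) hj.not_ge
    have hlin : X - C ((k + h * j : ℕ) : ℚ) ∈ coeffBall p fun l => (l : ℤ) - 1 :=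
      sub_mem (coeffBall.X_mem (by simp))
        (coeffBall.C_mem (padicBall.mem_of_le (padicBall.natCast_mem _) (by simp)))
    rw [newtonBasis, Finset.prod_range_succ, ← newtonBasis]
    exact coeffBall.mul_mem (fun i l => by push_cast; lia) (ih (by lia))
      (coeffBall.C_mul_mem (fun l => (zero_add _).ge) hinv hlin)

theorem apply_sub_coeff_zero_mul_mem {N : ℤ} {Q : ℚ[X]} (hQ : Q ∈ coeffBall p fun m => (m : ℤ) - 1)
    (T : ℚ[X] →ₗ[ℚ] ℚ) (hT : ∀ m : ℕ, 1 ≤ m → T (X ^ m) ∈ padicBall p (N + 1 - m)) :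
    T Q - Q.coeff 0 * T 1 ∈ padicBall p N := by
  have hsum : T Q - Q.coeff 0 * T 1 =
      ∑ m ∈ Finset.range Q.natDegree, Q.coeff (m + 1) * T (X ^ (m + 1)) := by
    conv_lhs => enter [1]; rw [Q.as_sum_range_C_mul_X_pow, map_sum, Finset.sum_range_succ']
    simp only [← smul_eq_C_mul, map_smul, smul_eq_mul, pow_zero, add_sub_cancel_right]
  rw [hsum]
  exact sum_mem fun m _ => padicBall.mul_mem (hQ (m + 1)) (hT (m + 1) m.succ_pos) (by lia)

theorem exists_newton_interpolation {L : ℕ} (hL : L + 3 ≤ p) (k : ℕ) :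
    ∃ Q ∈ coeffBall p fun m => (m : ℤ) - 1, ∀ s : ℕ,
      eulerBernoulli p (k + (p - 1) * s) - Q.eval ((k + (p - 1) * s : ℕ) : ℚ) ∈ padicBall p L := by
  have hp1 : ¬ p ∣ p - 1 := fun h => absurd (Nat.le_of_dvd (by lia) h) (by lia)
  refine ⟨∑ j ∈ Finset.range (L + 2),
    C (Δ_[p - 1] ^[j] (eulerBernoulli p) k) * newtonBasis k (p - 1) j,
    sum_mem fun j hj => ?_, fun s => ?_⟩
  · rw [Finset.mem_range] at hj
    exact coeffBall.C_mul_mem (fun l => by lia)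
      (fwdDiff_iter_eulerBernoulli_mem k le_rfl (fun h => by lia))
      (newtonBasis_mem k hp1 (by lia))
  · have hnewton : eulerBernoulli p (k + (p - 1) * s) =
        ∑ j ∈ Finset.range (L + 2 + s), Δ_[p - 1] ^[j] (eulerBernoulli p) k * s.choose j := by
      rw [mul_comm, ← smul_eq_mul, shift_eq_sum_fwdDiff_iter (p - 1) (eulerBernoulli p)]
      simp only [nsmul_eq_mul, mul_comm ((s.choose _ : ℕ) : ℚ)]
      refine Finset.sum_subset (Finset.range_subset_range.2 (by lia)) fun j _ hj => ?_
      rw [Nat.choose_eq_zero_of_lt (by simpa using hj), Nat.cast_zero, mul_zero]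
    simp only [hnewton, eval_finsetSum, eval_mul, eval_C,
      eval_newtonBasis k (show p - 1 ≠ 0 by lia), Finset.sum_range_add _ (L + 2) s,
      add_sub_cancel_left]
    exact sum_mem fun j _ => padicBall.mul_mem
      (fwdDiff_iter_eulerBernoulli_mem (e := L) k (by push_cast; lia) fun _ => by push_cast; lia)
      (padicBall.natCast_mem _) (by simp)

/-- The constant term is the value at `0`, to which `p ^ (L + 1) * k` is `p`-adically close. -/
theorem coeff_zero_mem_of_sub_eval_mem {L k : ℕ} (hk : ¬ p - 1 ∣ k) {Q : ℚ[X]}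
    (hQ : Q ∈ coeffBall p fun m => (m : ℤ) - 1)
    (h : eulerBernoulli p (p ^ (L + 1) * k) - Q.eval ((p ^ (L + 1) * k : ℕ) : ℚ) ∈ padicBall p L) :
    Q.coeff 0 ∈ padicBall p L := by
  set n := p ^ (L + 1) * k with hn
  have hn_mem : (n : ℚ) ∈ padicBall p (L + 1) :=
    padicBall.intCast_mem_of_dvd (z := n) (n := L + 1) (by simp [hn])
  have heval : Q.eval (n : ℚ) - Q.coeff 0 ∈ padicBall p L := by
    simpa using apply_sub_coeff_zero_mul_mem hQ (leval (n : ℚ)) fun m hm => by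
      obtain ⟨m, rfl⟩ := Nat.exists_eq_add_of_le' hm
      simpa [pow_succ] using
        padicBall.mul_mem (padicBall.pow_mem (padicBall.natCast_mem n) m) hn_mem (by lia)
  have hsmall : eulerBernoulli p n ∈ padicBall p L := by
    simpa using eulerBernoulli_pow_mul_mem hk (L + 1)
  convert sub_mem (sub_mem hsmall h) heval using 1
  ring

theorem exists_kummer_interpolation {L : ℕ} (hL : L + 3 ≤ p) (k : ℤ) :
    ∃ Q ∈ coeffBall p fun m => (m : ℤ) - 1,
      (∀ n : ℕ, (p : ℤ) - 1 ∣ n - k → eulerBernoulli p n - Q.eval (n : ℚ) ∈ padicBall p L) ∧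
      (¬ (p : ℤ) - 1 ∣ k → Q.coeff 0 ∈ padicBall p L) := by
  obtain ⟨k₀, hk₀⟩ : ∃ k₀ : ℕ, (k₀ : ℤ) = k % ((p : ℤ) - 1) :=
    Int.eq_ofNat_of_zero_le (Int.emod_nonneg _ (by lia)) |>.imp fun _ h => h.symm
  have hp_cast : ((p - 1 : ℕ) : ℤ) = (p : ℤ) - 1 := by lia
  have hk₀_sub : (p : ℤ) - 1 ∣ k - k₀ := hk₀ ▸ Int.dvd_self_sub_emod
  obtain ⟨Q, hQ, hQk₀⟩ := exists_newton_interpolation hL k₀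
  have hQn (n : ℕ) (hn : (p : ℤ) - 1 ∣ n - k) :
      eulerBernoulli p n - Q.eval (n : ℚ) ∈ padicBall p L := by
    have hmod : n % (p - 1) = k₀ := by
      zify
      rw [hp_cast, hk₀]
      exact (Int.modEq_iff_dvd.2 hn).symm
    simpa only [← hmod, Nat.mod_add_div] using hQk₀ (n / (p - 1))
  have hclass : (p : ℤ) - 1 ∣ ((p ^ (L + 1) * k₀ : ℕ) : ℤ) - k := by
    have hpow : (p : ℤ) - 1 ∣ (p : ℤ) ^ (L + 1) - 1 := by
      simpa using sub_dvd_pow_sub_pow (p : ℤ) 1 (L + 1)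
    have hsplit : ((p ^ (L + 1) * k₀ : ℕ) : ℤ) - k =
        ((p : ℤ) ^ (L + 1) - 1) * k₀ - (k - k₀) := by
      push_cast
      ring
    exact hsplit ▸ dvd_sub (hpow.mul_right _) hk₀_sub
  refine ⟨Q, hQ, hQn, fun hk => coeff_zero_mem_of_sub_eval_mem ?_ hQ (hQn _ hclass)⟩
  zify
  rwa [hp_cast, ← dvd_iff_dvd_of_dvd_sub hk₀_sub]

end Interpolation

section ResidueClass

variable {p : ℕ} [hp : Fact p.Prime] {L : ℕ} {M N k : ℤ}

theorem bernoulli_sub_eulerBernoulli_mem {n : ℕ} (hn : L + 2 ≤ n) :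
    _root_.bernoulli n - eulerBernoulli p n ∈ padicBall p L := by
  have hsub : _root_.bernoulli n - eulerBernoulli p n =
      (p : ℚ) ^ ((n : ℤ) - 1) * _root_.bernoulli n := by
    rw [eulerBernoulli]
    ring
  rw [hsub]
  exact padicBall.mul_mem (padicBall.zpow_self_mem _)
    (bernoulli_mem_padicBall (by lia) fun _ _ => le_rfl) (by lia)

/-- The contribution of an index with `f_i(1) = k` to the expression subtracted from `g_0` in
condition 1. The condition itself takes `t = X`, `G = g_i` and `x = f_i` in `ℚ(t)`; its value at a
prime takes `t = p`, `G = g_i(p)` and `x = f_i(p)` in `ℚ`. -/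
def mainTerm {F : Type*} [Field F] (t : F) (k : ℤ) (G x : F) : F :=
  if k = 0 then (1 - 1 / t) * G
  else if 2 ≤ k then (1 - t ^ (k - 1)) * ((bern k / k : ℚ) : F) * G * x
  else 0

theorem sum_mainTerm {F ι : Type*} [Field F] [Fintype ι] (t : F) (k : ι → ℤ) (G x : ι → F) :
    ∑ i, mainTerm t (k i) (G i) (x i) =
      (1 - 1 / t) * ∑ i with k i = 0, G i +
        ∑ i with 2 ≤ k i, (1 - t ^ (k i - 1)) * ((bern (k i) / k i : ℚ) : F) * G i * x i := by
  rw [Finset.mul_sum, Finset.sum_filter, Finset.sum_filter, ← Finset.sum_add_distrib]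
  refine Finset.sum_congr rfl fun i _ => ?_
  rw [mainTerm]
  split_ifs <;> first | lia | simp

theorem mainTerm_natCast {k : ℕ} (hk : 2 ≤ k) (p : ℕ) (G x : ℚ) :
    mainTerm (p : ℚ) k G x = G * ((k : ℚ)⁻¹ * x) * eulerBernoulli p k := by
  rw [mainTerm, if_neg (by lia), if_pos (by lia), bern, eulerBernoulli, Int.toNat_natCast,
    Rat.cast_id]
  push_cast
  ring

section Sums

variable {ι : Type*} {s : Finset ι} {n : ι → ℕ} {G : ι → ℚ}

theorem sum_mul_bernoulli_sub_sum_mul_eval_mem {Q : ℚ[X]} (hN : N ≤ M + L)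
    (hG : ∀ i ∈ s, G i ∈ padicBall p M) (hn : ∀ i ∈ s, L + 2 ≤ n i)
    (hQ : ∀ i ∈ s, eulerBernoulli p (n i) - Q.eval (n i : ℚ) ∈ padicBall p L) :
    ∑ i ∈ s, G i * _root_.bernoulli (n i) - ∑ i ∈ s, G i * Q.eval (n i : ℚ) ∈ padicBall p N := by
  simp only [← Finset.sum_sub_distrib, ← mul_sub]
  refine sum_mem fun i hi => padicBall.mul_mem (hG i hi) ?_ hN
  simpa using add_mem (bernoulli_sub_eulerBernoulli_mem (p := p) (hn i hi)) (hQ i hi)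

theorem sum_mul_bernoulli_sub_sum_mainTerm_mem_of_nonpos (hL : L + 3 ≤ p) (hN : N ≤ M + L)
    (hk : |k| < p - 1) (hk0 : k ≤ 0) (hG : ∀ i ∈ s, G i ∈ padicBall p M)
    (hn : ∀ i ∈ s, L + 2 ≤ n i) (hnk : ∀ i ∈ s, (p : ℤ) - 1 ∣ n i - k)
    (hpow : ∀ m : ℕ, 1 ≤ m → m + M ≤ N → ∑ i ∈ s, G i * (n i : ℚ) ^ m ∈ padicBall p (N + 1 - m)) :
    ∑ i ∈ s, G i * _root_.bernoulli (n i) - ∑ i ∈ s, mainTerm (p : ℚ) k (G i) (n i) ∈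
      padicBall p N := by
  obtain ⟨Q, hQ, hQn, hQ0⟩ := exists_kummer_interpolation hL k
  let T : ℚ[X] →ₗ[ℚ] ℚ := ∑ i ∈ s, G i • leval (n i : ℚ)
  have hT (P : ℚ[X]) : T P = ∑ i ∈ s, G i * P.eval (n i : ℚ) := by simp [T]
  have hTpow (m : ℕ) (hm : 1 ≤ m) : T (X ^ m) ∈ padicBall p (N + 1 - m) := by
    simp only [hT, eval_pow, eval_X]
    by_cases hmN : m + M ≤ N
    · exact hpow m hm hmN
    · exact sum_mem fun i hi => padicBall.mul_mem (hG i hi)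
        (padicBall.pow_mem (padicBall.natCast_mem _) m) (by lia)
  have hmain : Q.coeff 0 * T 1 - ∑ i ∈ s, mainTerm (p : ℚ) k (G i) (n i) ∈ padicBall p N := by
    simp only [hT, eval_one, mul_one, Finset.mul_sum, ← Finset.sum_sub_distrib]
    refine sum_mem fun i hi => ?_
    rcases eq_or_ne k 0 with rfl | hk0'
    · have hQ0' : Q.coeff 0 - (1 - 1 / (p : ℚ)) ∈ padicBall p L := by
        simpa [eulerBernoulli, coeff_zero_eq_eval_zero] using neg_mem (hQn 0 (by simp))
      simpa only [mainTerm, if_true, ← sub_mul] using padicBall.mul_mem hQ0' (hG i hi) (by lia)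
    · have hk_dvd : ¬ (p : ℤ) - 1 ∣ k := fun h => hk0' (Int.eq_zero_of_abs_lt_dvd h hk)
      rw [mainTerm, if_neg hk0', if_neg (by lia), sub_zero]
      exact padicBall.mul_mem (hQ0 hk_dvd) (hG i hi) (by lia)
  have hB := sum_mul_bernoulli_sub_sum_mul_eval_mem hN hG hn fun i hi => hQn _ (hnk i hi)
  rw [← hT] at hB
  convert add_mem (add_mem hB (apply_sub_coeff_zero_mul_mem hQ T hTpow)) hmain using 1
  ring

theorem sum_mul_bernoulli_sub_sum_mainTerm_mem_of_two_le {k : ℕ} (hL : L + 3 ≤ p)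
    (hN : N ≤ M + L) (hk : k + 1 < p) (hk2 : 2 ≤ k) (hG : ∀ i ∈ s, G i ∈ padicBall p M)
    (hn : ∀ i ∈ s, L + 2 ≤ n i) (hnk : ∀ i ∈ s, (p : ℤ) - 1 ∣ n i - k)
    (hpow : ∀ m : ℕ, 2 ≤ m → m + M ≤ N →
      ∑ i ∈ s, G i * ((n i : ℚ) ^ m - (k : ℚ) ^ (m - 1) * n i) ∈ padicBall p (N + 1 - m)) :
    ∑ i ∈ s, G i * _root_.bernoulli (n i) - ∑ i ∈ s, mainTerm (p : ℚ) k (G i) (n i) ∈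
      padicBall p N := by
  obtain ⟨Q, hQ, hQn, hQ0⟩ := exists_kummer_interpolation hL k
  have hk_dvd : ¬ (p : ℤ) - 1 ∣ k := fun h => by have := Int.le_of_dvd (by lia) h; lia
  have hGk (i) (hi : i ∈ s) : G i * ((k : ℚ)⁻¹ * n i) ∈ padicBall p M :=
    padicBall.mul_mem (hG i hi) (padicBall.mul_mem
      (padicBall.inv_natCast_mem (Nat.not_dvd_of_pos_of_lt (by lia) (by lia)))
      (padicBall.natCast_mem _) (add_zero (0 : ℤ)).ge) (add_zero M).ge
  set c : ℚ := ∑ i ∈ s, G i * ((k : ℚ)⁻¹ * n i) with hc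
  let T : ℚ[X] →ₗ[ℚ] ℚ := ∑ i ∈ s, G i • leval (n i : ℚ) - c • leval (k : ℚ)
  have hT (P : ℚ[X]) : T P = ∑ i ∈ s, G i * P.eval (n i : ℚ) - c * P.eval (k : ℚ) := by simp [T]
  have hTX (m : ℕ) : T (X ^ (m + 1)) =
      ∑ i ∈ s, G i * ((n i : ℚ) ^ (m + 1) - (k : ℚ) ^ m * n i) := by
    simp only [hT, eval_pow, eval_X, hc, Finset.sum_mul, ← Finset.sum_sub_distrib]
    refine Finset.sum_congr rfl fun i _ => ?_
    field_simp
    ring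
  have hTpow (m : ℕ) (hm : 1 ≤ m) : T (X ^ m) ∈ padicBall p (N + 1 - m) := by
    obtain ⟨m, rfl⟩ := Nat.exists_eq_add_of_le' hm
    rw [hTX]
    rcases m.eq_zero_or_pos with rfl | hm0
    · simp [zero_mem]
    by_cases hmN : (m + 1 : ℕ) + M ≤ N
    · exact hpow (m + 1) (by lia) hmN
    refine sum_mem fun i hi => padicBall.mul_mem (hG i hi) (M := 0) (sub_mem ?_ ?_) (by lia)
    · exact padicBall.pow_mem (padicBall.natCast_mem _) _
    · exact_mod_cast padicBall.natCast_mem (k ^ m * n i)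
  have hmain : c * Q.eval (k : ℚ) - ∑ i ∈ s, mainTerm (p : ℚ) k (G i) (n i) ∈ padicBall p N := by
    simp only [mainTerm_natCast hk2 p, hc, Finset.sum_mul, ← Finset.sum_sub_distrib, ← mul_sub]
    refine sum_mem fun i hi => padicBall.mul_mem (hGk i hi) ?_ hN
    simpa using neg_mem (hQn k (by simp))
  have hT1 : Q.coeff 0 * T 1 ∈ padicBall p N := padicBall.mul_mem (M := M) (hQ0 hk_dvd)
    (by simpa [hT] using sub_mem (sum_mem hG) (sum_mem hGk)) (by lia)
  have hB := sum_mul_bernoulli_sub_sum_mul_eval_mem hN hG hn fun i hi => hQn _ (hnk i hi)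
  have hTQ := apply_sub_coeff_zero_mul_mem hQ T hTpow
  convert add_mem (add_mem hB (add_mem hTQ hT1)) hmain using 1
  rw [hT]
  ring

theorem sum_mul_bernoulli_sub_sum_mainTerm_eq_zero_of_odd {k : ℤ} (hp2 : p ≠ 2) (hk : Odd k)
    (hn : ∀ i ∈ s, 2 ≤ n i) (hnk : ∀ i ∈ s, (p : ℤ) - 1 ∣ n i - k) :
    ∑ i ∈ s, G i * _root_.bernoulli (n i) - ∑ i ∈ s, mainTerm (p : ℚ) k (G i) (n i) = 0 := by
  have hp_even : Even ((p : ℤ) - 1) := by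
    simpa [Int.even_sub] using hp.out.odd_of_ne_two hp2
  rw [← Finset.sum_sub_distrib]
  refine Finset.sum_eq_zero fun i hi => ?_
  have hn_odd : Odd (n i) := by
    have := (even_iff_two_dvd.2 (hp_even.two_dvd.trans (hnk i hi))).add_odd hk
    simpa using this
  have hmain : mainTerm (p : ℚ) k (G i) (n i) = 0 := by
    rw [mainTerm, if_neg (by rintro rfl; simp at hk)]
    split_ifs with hk2
    · have hk_nat : Odd k.toNat := by grind
      simp [bern, bernoulli_eq_zero_of_odd hk_nat (by lia)]
    · rfl
  rw [bernoulli_eq_zero_of_odd hn_odd (hn i hi), hmain, mul_zero, sub_zero]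

theorem sum_mul_bernoulli_sub_sum_mainTerm_mem [Fintype ι] {k : ι → ℤ} (hL : L + 3 ≤ p)
    (hN : N ≤ M + L) (hk : ∀ i, |k i| < p - 1) (hG : ∀ i, G i ∈ padicBall p M)
    (hn : ∀ i, L + 2 ≤ n i) (hnk : ∀ i, (p : ℤ) - 1 ∣ n i - k i)
    (hpow₀ : ∀ j (m : ℕ), m + M ≤ N → Even (k j) → k j ≤ 0 → 1 ≤ m →
      ∑ i with k i = k j, G i * (n i : ℚ) ^ m ∈ padicBall p (N + 1 - m))
    (hpow₂ : ∀ j (m : ℕ), m + M ≤ N → Even (k j) → 0 < k j → 2 ≤ m →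
      ∑ i with k i = k j, G i * ((n i : ℚ) ^ m - (k j : ℚ) ^ (m - 1) * n i) ∈
        padicBall p (N + 1 - m)) :
    ∑ i, G i * _root_.bernoulli (n i) - ∑ i, mainTerm (p : ℚ) (k i) (G i) (n i) ∈
      padicBall p N := by
  have hmaps (i : ι) (_ : i ∈ Finset.univ) : k i ∈ Finset.univ.image k :=
    Finset.mem_image_of_mem k (Finset.mem_univ i)
  rw [← Finset.sum_sub_distrib, ← Finset.sum_fiberwise_of_maps_to hmaps]
  refine sum_mem fun κ hκ => ?_
  obtain ⟨j, -, rfl⟩ := Finset.mem_image.1 hκ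
  have hclass (i : ι) (hi : i ∈ ({i | k i = k j} : Finset ι)) : k i = k j := by simpa using hi
  have hnj (i : ι) (hi : i ∈ ({i | k i = k j} : Finset ι)) : (p : ℤ) - 1 ∣ n i - k j :=
    hclass i hi ▸ hnk i
  have hmain : ∑ i with k i = k j, mainTerm (p : ℚ) (k i) (G i) (n i) =
      ∑ i with k i = k j, mainTerm (p : ℚ) (k j) (G i) (n i) :=
    Finset.sum_congr rfl fun i hi => by rw [hclass i hi]
  rw [Finset.sum_sub_distrib, hmain]
  rcases Int.even_or_odd (k j) with hj_even | hj_odd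
  · rcases le_or_gt (k j) 0 with hj0 | hj0
    · exact sum_mul_bernoulli_sub_sum_mainTerm_mem_of_nonpos hL hN (hk j) hj0 (fun i _ => hG i)
        (fun i _ => hn i) hnj fun m hm hmN => hpow₀ j m hmN hj_even hj0 hm
    · obtain ⟨κ, hκj⟩ := Int.eq_ofNat_of_zero_le hj0.le
      have hκ := hk j
      rw [hκj] at hj_even hj0 hκ hnj ⊢
      exact sum_mul_bernoulli_sub_sum_mainTerm_mem_of_two_le hL hN (by grind) (by grind)
        (fun i _ => hG i) (fun i _ => hn i) hnj fun m hm hmN => by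
          simpa only [hκj, Int.cast_natCast] using hpow₂ j m hmN (hκj ▸ hj_even) (hκj ▸ hj0) hm
  · rw [sum_mul_bernoulli_sub_sum_mainTerm_eq_zero_of_odd (by lia) hj_odd
      (fun i _ => le_of_add_le_right (hn i)) hnj]
    exact zero_mem _

end Sums

end ResidueClass

section TAdicValuation

open scoped RatFunc

theorem tVal_X_zpow (k : ℤ) : tVal (RatFunc.X ^ k) = k := by
  change HahnSeries.addVal ℤ ℚ (algebraMap (RatFunc ℚ) (LaurentSeries ℚ) (RatFunc.X ^ k)) = k
  rw [map_zpow₀, RatFunc.coe_X, ← RatFunc.single_zpow, HahnSeries.addVal_apply,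
    HahnSeries.orderTop_single one_ne_zero]

theorem tVal_algebraMap_eq_zero {q : ℚ[X]} (hq : q.coeff 0 ≠ 0) :
    tVal (algebraMap ℚ[X] (RatFunc ℚ) q) = 0 := by
  change HahnSeries.addVal ℤ ℚ (algebraMap (RatFunc ℚ) (LaurentSeries ℚ) q) = 0
  rw [← RatFunc.coe_coe, HahnSeries.addVal_apply]
  refine HahnSeries.orderTop_eq_of_le (g := 0) ?_ fun i hi => ?_
  · simpa [PowerSeries.coeff_coe] using hq
  · by_contra! hi0
    simp [PowerSeries.coeff_coe, hi0] at hi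

theorem exists_eq_X_pow_mul {q : ℚ[X]} (hq : q ≠ 0) :
    ∃ (r : ℕ) (a : ℚ[X]), a.coeff 0 ≠ 0 ∧ q = X ^ r * a := by
  obtain ⟨a, ha, ha0⟩ := exists_eq_pow_rootMultiplicity_mul_and_not_dvd q hq 0
  simp only [C_0, sub_zero, X_dvd_iff] at ha ha0
  exact ⟨_, a, ha0, ha⟩

theorem exists_eq_X_zpow_mul_div {g : RatFunc ℚ} (hg : g ≠ 0) :
    ∃ (k : ℤ) (a b : ℚ[X]), a.coeff 0 ≠ 0 ∧ b.coeff 0 ≠ 0 ∧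
      g = RatFunc.X ^ k * (algebraMap ℚ[X] (RatFunc ℚ) a / algebraMap ℚ[X] (RatFunc ℚ) b) := by
  obtain ⟨r, a, ha, hra⟩ := exists_eq_X_pow_mul (RatFunc.num_ne_zero hg)
  obtain ⟨s, b, hb, hsb⟩ := exists_eq_X_pow_mul g.denom_ne_zero
  refine ⟨r - s, a, b, ha, hb, ?_⟩
  conv_lhs => rw [← RatFunc.num_div_denom g, hra, hsb]
  simp only [map_mul, map_pow, RatFunc.algebraMap_X,
    zpow_sub₀ (RatFunc.X_ne_zero (K := ℚ)), zpow_natCast, mul_div_mul_comm]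

end TAdicValuation

section EvalGerm

open Filter

theorem eventually_eval_ne_zero {q : ℚ[X]} (hq : q ≠ 0) :
    ∀ᶠ p : ℕ in atTop, q.eval (p : ℚ) ≠ 0 := by
  rw [← Nat.cofinite_eq_atTop]
  exact ((q.finite_setOfPred_isRoot hq).preimage Nat.cast_injective.injOn).compl_mem_cofinite

/-- The homomorphism that sends a rational function to the germ at infinity of its values at the
natural numbers. The finitely many poles make `evalAt p` itself no homomorphism. -/
noncomputable def evalGerm : RatFunc ℚ →+* Germ (atTop : Filter ℕ) ℚ where
  toFun g := ((fun p : ℕ => evalAt p g : ℕ → ℚ) : Germ atTop ℚ)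
  map_zero' := congrArg _ (_root_.funext fun _ => RatFunc.eval_zero _ _)
  map_one' := congrArg _ (_root_.funext fun _ => RatFunc.eval_one _ _)
  map_add' g h := Germ.coe_eq.2 <| by
    filter_upwards [eventually_eval_ne_zero g.denom_ne_zero,
      eventually_eval_ne_zero h.denom_ne_zero] with p hg hh using RatFunc.eval_add _ _ hg hh
  map_mul' g h := Germ.coe_eq.2 <| by
    filter_upwards [eventually_eval_ne_zero g.denom_ne_zero,
      eventually_eval_ne_zero h.denom_ne_zero] with p hg hh using RatFunc.eval_mul _ _ hg hh

theorem evalGerm_apply (g : RatFunc ℚ) :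
    evalGerm g = ((fun p : ℕ => evalAt p g : ℕ → ℚ) : Germ atTop ℚ) := rfl

theorem evalGerm_eq_coe_iff {g : RatFunc ℚ} {φ : ℕ → ℚ} :
    evalGerm g = (φ : Germ atTop ℚ) ↔ ∀ᶠ p : ℕ in atTop, evalAt p g = φ p := Germ.coe_eq

theorem evalGerm_algebraMap (q : ℚ[X]) :
    evalGerm (algebraMap ℚ[X] (RatFunc ℚ) q) = ((fun p : ℕ => q.eval (p : ℚ)) : Germ atTop ℚ) :=
  evalGerm_eq_coe_iff.2 <| .of_forall fun p => by simp [evalAt]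

theorem evalGerm_X : evalGerm RatFunc.X = ((fun p : ℕ => (p : ℚ)) : Germ atTop ℚ) :=
  evalGerm_eq_coe_iff.2 <| .of_forall fun _ => RatFunc.eval_X _ _

theorem evalGerm_C (c : ℚ) : evalGerm (RatFunc.C c) = ((fun _ : ℕ => c) : Germ atTop ℚ) :=
  evalGerm_eq_coe_iff.2 <| .of_forall fun _ => RatFunc.eval_C _ _

theorem evalGerm_toRatFunc (f : ℤ[X]) :
    evalGerm (toRatFunc f) = ((fun p : ℕ => ((f.eval (p : ℤ) : ℤ) : ℚ)) : Germ atTop ℚ) := by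
  rw [toRatFunc, evalGerm_algebraMap]
  simp [eval_map]

theorem evalGerm_inv (g : RatFunc ℚ) : evalGerm g⁻¹ = (evalGerm g)⁻¹ := by
  rcases eq_or_ne g 0 with rfl | hg
  · rw [inv_zero, map_zero]
    exact congrArg _ (_root_.funext fun _ => by simp)
  · have hmul : evalGerm g⁻¹ * evalGerm g = 1 := by rw [← map_mul, inv_mul_cancel₀ hg, map_one]
    refine Germ.coe_eq.2 ?_
    filter_upwards [Germ.coe_eq.1 hmul] with p hp using eq_inv_of_mul_eq_one_left hp

theorem evalGerm_div (g h : RatFunc ℚ) : evalGerm (g / h) = evalGerm g / evalGerm h :=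
  map_div' evalGerm evalGerm_inv g h

theorem evalGerm_zpow (g : RatFunc ℚ) (k : ℤ) : evalGerm (g ^ k) = evalGerm g ^ k :=
  map_zpow' evalGerm evalGerm_inv g k

theorem germ_coe_sum {ι : Type*} (s : Finset ι) (φ : ι → ℕ → ℚ) :
    ((fun p => ∑ i ∈ s, φ i p : ℕ → ℚ) : Germ (atTop : Filter ℕ) ℚ) = ∑ i ∈ s, ↑(φ i) := by
  simpa [Finset.sum_fn] using map_sum (Germ.coeRingHom (R := ℚ) (atTop : Filter ℕ)) φ s

end EvalGerm

section LargePrimes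

open Filter

theorem eventually_mem_padicBall_zero (c : ℚ) :
    ∀ᶠ p : ℕ in atTop, ∀ [Fact p.Prime], c ∈ padicBall p 0 := by
  filter_upwards [eventually_gt_atTop c.den] with p hp _
  rw [← Rat.num_div_den c, div_eq_mul_inv]
  exact padicBall.mul_mem (padicBall.intCast_mem c.num)
    (padicBall.inv_natCast_mem (Nat.not_dvd_of_pos_of_lt c.pos hp)) (add_zero (0 : ℤ)).ge

theorem eventually_eval_mem_padicBall_zero (q : ℚ[X]) :
    ∀ᶠ p : ℕ in atTop, ∀ [Fact p.Prime], q.eval (p : ℚ) ∈ padicBall p 0 := by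
  filter_upwards [(eventually_all_finset q.support).2 fun i _ =>
    eventually_mem_padicBall_zero (q.coeff i)] with p hq _
  rw [eval_eq_sum, Polynomial.sum]
  exact sum_mem fun i hi => padicBall.mul_mem (hq i hi)
    (padicBall.pow_mem (padicBall.natCast_mem p) i) (add_zero (0 : ℤ)).ge

theorem eventually_inv_eval_mem_padicBall_zero {q : ℚ[X]} (hq : q.coeff 0 ≠ 0) :
    ∀ᶠ p : ℕ in atTop, ∀ [Fact p.Prime], (q.eval (p : ℚ))⁻¹ ∈ padicBall p 0 := by
  filter_upwards [eventually_mem_padicBall_zero (q.coeff 0)⁻¹,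
    eventually_eval_mem_padicBall_zero q.divX] with p hc hdivX _
  have hsub : q.eval (p : ℚ) - q.coeff 0 = (p : ℚ) ^ (1 : ℤ) * q.divX.eval (p : ℚ) := by
    nth_rewrite 1 [← divX_mul_X_add q]
    rw [eval_add, eval_mul, eval_X, eval_C, zpow_one]
    ring
  refine padicBall.inv_mem_of_sub_mem hq hc ?_
  rw [hsub]
  exact padicBall.mul_mem (padicBall.zpow_self_mem 1) hdivX (add_zero (1 : ℤ)).ge

theorem eventually_evalAt_mem_padicBall {g : RatFunc ℚ} {N : ℤ} (hg : N ≤ tVal g) :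
    ∀ᶠ p : ℕ in atTop, ∀ [Fact p.Prime], evalAt p g ∈ padicBall p N := by
  rcases eq_or_ne g 0 with rfl | hg0
  · simp [evalAt, zero_mem]
  obtain ⟨k, a, b, ha, hb, rfl⟩ := exists_eq_X_zpow_mul_div hg0
  have hk : N ≤ k := by
    simpa [AddValuation.map_mul, tVal_X_zpow, tVal_algebraMap_eq_zero ha,
      tVal_algebraMap_eq_zero hb] using hg
  have hgerm : evalGerm (RatFunc.X ^ k * (algebraMap ℚ[X] _ a / algebraMap ℚ[X] _ b)) =
      ((fun p : ℕ => (p : ℚ) ^ k * (a.eval (p : ℚ) / b.eval (p : ℚ)) : ℕ → ℚ) :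
        Germ atTop ℚ) := by
    rw [map_mul, evalGerm_zpow, evalGerm_div, evalGerm_X, evalGerm_algebraMap, evalGerm_algebraMap]
    rfl
  filter_upwards [evalGerm_eq_coe_iff.1 hgerm, eventually_eval_mem_padicBall_zero a,
    eventually_inv_eval_mem_padicBall_zero hb] with p hp ha hb _
  rw [hp, div_eq_mul_inv]
  exact padicBall.mul_mem (padicBall.zpow_self_mem k)
    (padicBall.mul_mem ha hb (add_zero (0 : ℤ)).ge) (by lia)

theorem eventually_le_eval {f : ℤ[X]} (hdeg : 0 < f.natDegree) (hlead : 0 < f.leadingCoeff)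
    (c : ℤ) : ∀ᶠ p : ℕ in atTop, c ≤ f.eval (p : ℤ) := by
  have hinj := Int.cast_injective (α := ℚ)
  have hlim := tendsto_atTop_of_leadingCoeff_nonneg (f.map (Int.castRingHom ℚ))
    (by rwa [degree_map_eq_of_injective hinj, ← natDegree_pos_iff_degree_pos])
    (by rw [leadingCoeff_map_of_injective hinj]; simpa using hlead.le)
  filter_upwards [(hlim.comp tendsto_natCast_atTop_atTop).eventually_ge_atTop (c : ℚ)] with p hp
  have heval : (f.map (Int.castRingHom ℚ)).eval (p : ℚ) = ((f.eval (p : ℤ) : ℤ) : ℚ) := by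
    simp [eval_map]
  rw [Function.comp_apply, heval] at hp
  exact_mod_cast hp

end LargePrimes

section Conditions

open Filter

variable {ι : Type*} {s : Finset ι} {f : ι → ℤ[X]} {g : ι → RatFunc ℚ} {M N K : ℤ} {m : ℕ}

theorem eventually_sum_mul_pow_mem (h : K ≤ tVal (∑ i ∈ s, g i * toRatFunc (f i) ^ m)) :
    ∀ᶠ p : ℕ in atTop, ∀ [Fact p.Prime],
      ∑ i ∈ s, evalAt p (g i) * (((f i).eval (p : ℤ) : ℤ) : ℚ) ^ m ∈ padicBall p K := by
  have hgerm : evalGerm (∑ i ∈ s, g i * toRatFunc (f i) ^ m) =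
      ((fun p : ℕ => ∑ i ∈ s, evalAt p (g i) * (((f i).eval (p : ℤ) : ℤ) : ℚ) ^ m : ℕ → ℚ) :
        Germ atTop ℚ) := by
    simp only [map_sum, map_mul, map_pow, evalGerm_toRatFunc, germ_coe_sum]
    rfl
  filter_upwards [evalGerm_eq_coe_iff.1 hgerm, eventually_evalAt_mem_padicBall h] with p hp hmem _
  exact hp ▸ hmem

theorem eventually_sum_mul_pow_sub_mem {k : ℤ} (h : K ≤ tVal (∑ i ∈ s,
      g i * (toRatFunc (f i) ^ m - (k : RatFunc ℚ) ^ (m - 1) * toRatFunc (f i)))) :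
    ∀ᶠ p : ℕ in atTop, ∀ [Fact p.Prime],
      ∑ i ∈ s, evalAt p (g i) * ((((f i).eval (p : ℤ) : ℤ) : ℚ) ^ m -
        (k : ℚ) ^ (m - 1) * ((f i).eval (p : ℤ) : ℤ)) ∈ padicBall p K := by
  have hgerm : evalGerm (∑ i ∈ s,
      g i * (toRatFunc (f i) ^ m - (k : RatFunc ℚ) ^ (m - 1) * toRatFunc (f i))) =
      ((fun p : ℕ => ∑ i ∈ s, evalAt p (g i) * ((((f i).eval (p : ℤ) : ℤ) : ℚ) ^ m -
        (k : ℚ) ^ (m - 1) * ((f i).eval (p : ℤ) : ℤ)) : ℕ → ℚ) : Germ atTop ℚ) := by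
    rw [← map_intCast (RatFunc.C (K := ℚ)) k]
    simp only [map_sum, map_mul, map_sub, map_pow, evalGerm_toRatFunc, evalGerm_C, germ_coe_sum]
    rfl
  filter_upwards [evalGerm_eq_coe_iff.1 hgerm, eventually_evalAt_mem_padicBall h] with p hp hmem _
  exact hp ▸ hmem

theorem evalGerm_mainTerm (k : ℤ) (g : RatFunc ℚ) (f : ℤ[X]) :
    evalGerm (mainTerm RatFunc.X k g (toRatFunc f)) =
      ((fun p : ℕ => mainTerm (p : ℚ) k (evalAt p g) (f.eval (p : ℤ) : ℤ) : ℕ → ℚ) :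
        Germ atTop ℚ) := by
  simp only [mainTerm]
  split_ifs
  · rw [map_mul, map_sub, evalGerm_div, map_one, evalGerm_X]
    rfl
  · rw [map_mul, map_mul, map_mul, map_sub, map_one, evalGerm_zpow, evalGerm_X,
      ← eq_ratCast (RatFunc.C (K := ℚ)), evalGerm_C, evalGerm_toRatFunc]
    rfl
  · exact map_zero _

theorem eventually_evalAt_sub_sum_mainTerm_mem [Fintype ι] {g₀ : RatFunc ℚ}
    (h : N ≤ tVal (g₀ - ∑ i, mainTerm RatFunc.X ((f i).eval 1) (g i) (toRatFunc (f i)))) :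
    ∀ᶠ p : ℕ in atTop, ∀ [Fact p.Prime], evalAt p g₀ -
      ∑ i, mainTerm (p : ℚ) ((f i).eval 1) (evalAt p (g i)) ((f i).eval (p : ℤ) : ℤ) ∈
        padicBall p N := by
  have hgerm : evalGerm (g₀ -
      ∑ i, mainTerm RatFunc.X ((f i).eval 1) (g i) (toRatFunc (f i))) =
      ((fun p : ℕ => evalAt p g₀ - ∑ i, mainTerm (p : ℚ) ((f i).eval 1) (evalAt p (g i))
        ((f i).eval (p : ℤ) : ℤ) : ℕ → ℚ) : Germ atTop ℚ) := by
    rw [map_sub, map_sum, evalGerm_apply g₀]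
    simp only [evalGerm_mainTerm, ← germ_coe_sum]
    rfl
  filter_upwards [evalGerm_eq_coe_iff.1 hgerm, eventually_evalAt_mem_padicBall h] with p hp hmem _
  exact hp ▸ hmem

theorem eventually_forall_of_add_le [Finite ι] {P : ℕ → ι → ℕ → Prop}
    (h : ∀ j (m : ℕ), m + M ≤ N → ∀ᶠ p in atTop, P p j m) :
    ∀ᶠ p in atTop, ∀ j (m : ℕ), m + M ≤ N → P p j m := by
  have hfin : {m : ℕ | m + M ≤ N}.Finite :=
    (Set.finite_Iic (N - M).toNat).subset fun m hm => by simp at hm ⊢; lia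
  exact eventually_all.2 fun j => (eventually_all_finite hfin).2 (h j)

theorem eventually_sum_mul_bern_sub_sum_mainTerm_mem [Fintype ι]
    (hf_deg : ∀ i, 0 < (f i).natDegree) (hf_lead : ∀ i, 0 < (f i).leadingCoeff)
    (hg : ∀ i, M ≤ tVal (g i))
    (hpow₀ : ∀ j (m : ℕ), m + M ≤ N → Even ((f j).eval 1) → (f j).eval 1 ≤ 0 → 1 ≤ m →
      (N + 1 - m : ℤ) ≤ tVal (∑ i with (f i).eval 1 = (f j).eval 1, g i * toRatFunc (f i) ^ m))
    (hpow₂ : ∀ j (m : ℕ), m + M ≤ N → Even ((f j).eval 1) → 0 < (f j).eval 1 → 2 ≤ m →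
      (N + 1 - m : ℤ) ≤ tVal (∑ i with (f i).eval 1 = (f j).eval 1, g i *
        (toRatFunc (f i) ^ m - (((f j).eval 1 : ℤ) : RatFunc ℚ) ^ (m - 1) * toRatFunc (f i)))) :
    ∀ᶠ p : ℕ in atTop, ∀ [Fact p.Prime], ∑ i, evalAt p (g i) * bern ((f i).eval (p : ℤ)) -
      ∑ i, mainTerm (p : ℚ) ((f i).eval 1) (evalAt p (g i)) ((f i).eval (p : ℤ) : ℤ) ∈
        padicBall p N := by
  set L := (N - M).toNat
  have hpow₀' := eventually_forall_of_add_le fun j m hm =>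
    eventually_imp_distrib_left.2 fun hj => eventually_imp_distrib_left.2 fun hj0 =>
      eventually_imp_distrib_left.2 fun hm1 => eventually_sum_mul_pow_mem (hpow₀ j m hm hj hj0 hm1)
  have hpow₂' := eventually_forall_of_add_le fun j m hm =>
    eventually_imp_distrib_left.2 fun hj => eventually_imp_distrib_left.2 fun hj0 =>
      eventually_imp_distrib_left.2 fun hm2 =>
        eventually_sum_mul_pow_sub_mem (hpow₂ j m hm hj hj0 hm2)
  have hp_large : ∀ᶠ p : ℕ in atTop, ∀ i, |(f i).eval 1| < (p : ℤ) - 1 := by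
    refine eventually_all.2 fun i => ?_
    filter_upwards [eventually_gt_atTop (|(f i).eval 1| + 1).toNat] with p hp
    lia
  filter_upwards [hpow₀', hpow₂', hp_large, eventually_ge_atTop (L + 3),
    eventually_all.2 fun i => eventually_evalAt_mem_padicBall (hg i),
    eventually_all.2 fun i => eventually_le_eval (hf_deg i) (hf_lead i) (L + 2)]
    with p hp₀ hp₂ hk hL hG hn _
  choose n hn_eq using fun i => Int.eq_ofNat_of_zero_le (le_trans (by lia) (hn i))
  have hnk (i : ι) : (p : ℤ) - 1 ∣ n i - (f i).eval 1 := by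
    rw [← hn_eq]
    exact sub_dvd_eval_sub (p : ℤ) 1 (f i)
  simp only [hn_eq, bern, Int.toNat_natCast, Int.cast_natCast] at hp₀ hp₂ hn ⊢
  exact sum_mul_bernoulli_sub_sum_mainTerm_mem (L := L) hL (by lia) hk (fun i => hG i)
    (fun i => by exact_mod_cast hn i) hnk (fun j m hm h h' h'' => hp₀ j m hm h h' h'')
    fun j m hm h h' h'' => hp₂ j m hm h h' h''

theorem exists_int_le_forall_add_le (N : ℤ) (M : WithTop ℤ) : ∃ M₀ : ℤ, M₀ ≤ M ∧
    ∀ m : ℕ, 1 ≤ m → m + M₀ ≤ N → ((m : ℤ) : WithTop ℤ) + M ≤ N := by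
  induction M using WithTop.recTopCoe with
  | top => exact ⟨N, le_top, fun m hm hmN => by lia⟩
  | coe M₀ => exact ⟨M₀, le_rfl, fun m _ hmN => by exact_mod_cast hmN⟩

end Conditions

theorem theorem1 (N : ℤ) (n : ℕ) (f : Fin n → Polynomial ℤ)
    (hf_deg : ∀ i, 0 < (f i).natDegree) (hf_lead : ∀ i, 0 < (f i).leadingCoeff)
    (g₀ : RatFunc ℚ) (g : Fin n → RatFunc ℚ)
    (M : WithTop ℤ) (hM : M = min (tVal g₀) (Finset.univ.inf fun i => tVal (g i)))
    (h1 : (N : WithTop ℤ) ≤ tVal (g₀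
      - (1 - 1 / RatFunc.X) * ∑ i with (f i).eval 1 = 0, g i
      - ∑ i with 2 ≤ (f i).eval 1,
          (1 - RatFunc.X ^ ((f i).eval 1 - 1))
            * RatFunc.C (bern ((f i).eval 1) / (((f i).eval 1 : ℤ) : ℚ)) * g i * toRatFunc (f i)))
    (h2 : ∀ k : ℤ, (∃ i, (f i).eval 1 = k) → Even k → k ≤ 0 →
      ∀ m : ℕ, 1 ≤ m → ((m : ℤ) : WithTop ℤ) + M ≤ (N : WithTop ℤ) →
        ((N + 1 - m : ℤ) : WithTop ℤ) ≤
          tVal (∑ i with (f i).eval 1 = k, g i * toRatFunc (f i) ^ m))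
    (h3 : ∀ k : ℤ, (∃ i, (f i).eval 1 = k) → Even k → 0 < k →
      ∀ m : ℕ, 2 ≤ m → ((m : ℤ) : WithTop ℤ) + M ≤ (N : WithTop ℤ) →
        ((N + 1 - m : ℤ) : WithTop ℤ) ≤
          tVal (∑ i with (f i).eval 1 = k,
            g i * (toRatFunc (f i) ^ m - (k : RatFunc ℚ) ^ (m - 1) * toRatFunc (f i)))) :
    ∃ P : ℕ, ∀ p : ℕ, p.Prime → P ≤ p →
      RatCongr p N (∑ i, evalAt (p : ℚ) (g i) * bern ((f i).eval (p : ℤ))) (evalAt (p : ℚ) g₀) := by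
  obtain ⟨M₀, hM₀, hm⟩ := exists_int_le_forall_add_le N M
  have hg (i : Fin n) : (M₀ : WithTop ℤ) ≤ tVal (g i) :=
    hM₀.trans (hM ▸ (min_le_right _ _).trans (Finset.inf_le (Finset.mem_univ i)))
  have hsum := eventually_sum_mul_bern_sub_sum_mainTerm_mem hf_deg hf_lead hg
    (fun j m hmN hj hj0 hm1 => h2 _ ⟨j, rfl⟩ hj hj0 m hm1 (hm m hm1 hmN))
    fun j m hmN hj hj0 hm2 => h3 _ ⟨j, rfl⟩ hj hj0 m hm2 (hm m (by lia) hmN)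
  have hmain := eventually_evalAt_sub_sum_mainTerm_mem (by
    simpa only [sum_mainTerm, ← sub_sub, ← eq_ratCast (RatFunc.C (K := ℚ))] using h1)
  obtain ⟨P, hP⟩ := Filter.eventually_atTop.1 (hsum.and hmain)
  refine ⟨P, fun p hp hpP => ?_⟩
  have : Fact p.Prime := ⟨hp⟩
  exact padicBall.ratCongr_of_sub_mem (by simpa using sub_mem (hP p hpP).1 (hP p hpP).2)
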